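/- Let $T>0$, $I=(0,T)$, $d\in\mathbb N$, let $Y$ be a real Hilbert space, $K\colon L^2(I;\mathbb R^d)\to Y$ linear and continuous, $F\colon Y\to\mathbb R$ strictly convex and continuously Fréchet differentiable, and $\beta>0$. Let $\mathcal C_0(I;\mathbb R^d)$ be the continuous functions on $I$ vanishing at its boundary, with norm $\|\varphi\|_{\mathcal C}=\sup_{t\in I}|\varphi(t)|$, let $\mathcal M(I;\mathbb R^d)$ be its dual, the space of vector measures, with pairing $\langle\cdot,\cdot\rangle$ and dual norm $\|\cdot\|_{\mathcal M}$, and let $BV(I;\mathbb R^d)$ be the set of $u\in L^1(I;\mathbb R^d)$ whose distributional derivative $u'$ lies in $\mathcal M(I;\mathbb R^d)$, with norm $\|u'\|_{\mathcal M}+\|u\|_{L^1}$. Consider $$\min_{u\in BV(I;\mathbb R^d)} j(u)=F(Ku)+\beta\|u'\|_{\mathcal M},\tag{$\mathcal P$}$$ and assume that $\|u_i\|_{BV}\to\infty$ implies $j(u_i)\to+\infty$. Put $$B(q,c)=\int_0^{\cdot}\mathrm dq-\frac1T\int_0^T\int_0^s\mathrm dq\,\mathrm ds+c,\qquad q\in\mathcal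 M(I;\mathbb R^d),\ c\in\mathbb R^d .$$ Algorithm. A jump is a measure $v=\mathbf v\,\delta_t$ with $t\in I$, $\mathbf v\in\mathbb R^d$, $|\mathbf v|=1$. Given a finite family of jumps $(v_i)_{i=1}^N$, the subproblem for $(v_i)$ is $$\min_{\mu\in\mathbb R^N,\ \mu_i\ge0,\ c\in\mathbb R^d}\ F\Big(KB\Big(\sum_{i=1}^N\mu_iv_i,\,c\Big)\Big)+\beta\sum_{i=1}^N\mu_i .$$ Let an arbitrary finite active set $\mathcal A_0=\{(\mu^0_i,v^0_i)\}_{i=1}^{N_0}$ with $\mu_i^0>0$ be given. Let $(\mu,c^1)$ be a solution of the subproblem for $(v^0_i)$, and let $\mathcal A_1$ consist of those pairs $(\mu_i,v_i^0)$ with $\mu_i>0$. For $k\ge1$, given $\mathcal A_k=\{(\mu^k_i,v^k_i)\}_{i=1}^{N_k}$ with $v_i^k=\mathbf v_i^k\delta_{t_i^k}$ and $c^k$, set $$u_k=B\Big(\sum_{i=1}^{N_k}\mu_i^kv_i^k,\,c^k\Big),\qquad p_k(t)=\int_0^tK^*\nabla F(Ku_k)(s)\,\mathrm ds .$$ If $\|p_k\|_{\mathcal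 C}\le\beta$, stop. Otherwise choose $\hat t_k\in I$ with $|p_k(\hat t_k)|=\|p_k\|_{\mathcal C}$, set $\widehat v^k=(p_k(\hat t_k)/\|p_k\|_{\mathcal C})\,\delta_{\hat t_k}$, let $(\mu,c^{k+1})$ be a solution of the subproblem for $(v^k_1,\dots,v^k_{N_k},\widehat v^k)$, and let $\mathcal A_{k+1}$ consist of the pairs of magnitude and jump with positive magnitude. Active sets are understood as finite families. Proposition. For every iteration $k\ge1$ reached by the algorithm: 1. $p_k\in\mathcal C_0(I;\mathbb R^d)$. 2. $\langle p_k,v_i^k\rangle=(p_k(t_i^k),\mathbf v_i^k)_{\mathbb R^d}=\beta$ for all $i=1,\dots,N_k$. 3. $\langle p_k,u_k'\rangle=\beta\sum_{i=1}^{N_k}\mu_i^k$. 4. If $\mathcal A_k\ne\emptyset$, then $\|p_k\|_{\mathcal C}\ge\beta$. 5. If $\|p_k\|_{\mathcal C}\le\beta$, then $u_k$ is a minimizer of $(\mathcal P)$. 6. If $\|p_k\|_{\mathcal C}>0$ and for some $\hat t_k\in I$ with $|p_k(\hat t_k)|=\|p_k\|_{\mathcal C}$ the candidate jump $\widehat v^k=(p_k(\hat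 t_k)/\|p_k\|_{\mathcal C})\,\delta_{\hat t_k}$ is one of the jumps $v_i^k$ of $\mathcal A_k$, then $\|p_k\|_{\mathcal C}=\beta$ and $u_k$ is a minimizer of $(\mathcal P)$. -/

import Mathlib

open MeasureTheory Set Filter Topology
open scoped ContDiff ENNReal InnerProductSpace ZeroAtInfty

namespace PDAJ

/-- `ℝ^d` with the Euclidean norm and inner product. -/
abbrev Vec (d : ℕ) : Type := EuclideanSpace ℝ (Fin d)

/-- An `ℝ^d`-valued measure has finite total variation. -/
theorem isFiniteMeasure_variation {X : Type*} [MeasurableSpace X] {d : ℕ}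
    (q : VectorMeasure X (Vec d)) : IsFiniteMeasure q.variation := by
  let p : Fin d → SignedMeasure X := fun i =>
    q.mapRange (EuclideanSpace.proj (𝕜 := ℝ) i : Vec d →L[ℝ] ℝ).toLinearMap.toAddMonoidHom
      (EuclideanSpace.proj (𝕜 := ℝ) i : Vec d →L[ℝ] ℝ).continuous
  have h : q.variation ≤ ∑ i, (p i).totalVariation := by
    refine VectorMeasure.variation_le_of_forall_enorm_le (fun s _ => ?_)
    have h1 : ‖q s‖ₑ ≤ ∑ i, ‖q s i‖ₑ := by
      have h2 : ‖q s‖ ≤ ∑ i, ‖q s i‖ := by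
        rw [EuclideanSpace.norm_eq]
        refine Real.sqrt_le_iff.2 ⟨Finset.sum_nonneg fun _ _ => norm_nonneg _, ?_⟩
        exact Finset.sum_sq_le_sq_sum_of_nonneg fun _ _ => norm_nonneg _
      calc ‖q s‖ₑ = ENNReal.ofReal ‖q s‖ := (ofReal_norm _).symm
        _ ≤ ENNReal.ofReal (∑ i, ‖q s i‖) := ENNReal.ofReal_le_ofReal h2
        _ = ∑ i, ‖q s i‖ₑ := by
          rw [ENNReal.ofReal_sum_of_nonneg fun _ _ => norm_nonneg _]
          exact Finset.sum_congr rfl fun i _ => ofReal_norm _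
    refine h1.trans ?_
    rw [Measure.finsetSum_apply]
    exact Finset.sum_le_sum fun i _ => SignedMeasure.enorm_le_totalVariation (p i) s
  exact isFiniteMeasure_of_le _ h

/-- Fubini's theorem for a vector measure and a positive measure. -/
theorem integral_integral_swap {X Y : Type*} [MeasurableSpace X] [MeasurableSpace Y] {d : ℕ}
    (q : VectorMeasure X (Vec d)) (m : Measure Y) {g : Y → Vec d} (hg : Integrable g m)
    {S : Set (X × Y)} (hS : MeasurableSet S) :
    ∫ᵛ x, (∫ t in {t | (x, t) ∈ S}, g t ∂m) ∂[innerSL ℝ; q] =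
      ∫ t, ⟪g t, q {x | (x, t) ∈ S}⟫_ℝ ∂m := by
  classical
  have := isFiniteMeasure_variation q
  have hmeas (A : Set (X × Y)) (hA : MeasurableSet A) :
      AEStronglyMeasurable (fun t => q {x | (x, t) ∈ A}) m := by
    have := VectorMeasure.stronglyMeasurable_vectorMeasure_prodMk_left (ν := q)
      (measurable_swap hA)
    exact this.aestronglyMeasurable
  have hint (A : Set (X × Y)) (hA : MeasurableSet A) :
      Integrable (fun t => ⟪g t, q {x | (x, t) ∈ A}⟫_ℝ) m := by
    refine (hg.norm.mul_const (q.bound : ℝ)).mono' (hg.1.inner (hmeas A hA)) ?_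
    filter_upwards with t
    exact (norm_inner_le_norm _ _).trans
      (mul_le_mul_of_nonneg_left VectorMeasure.norm_apply_le_bound (norm_nonneg _))
  let ρ : VectorMeasure (X × Y) ℝ :=
    { measureOf' := fun A => if MeasurableSet A then ∫ t, ⟪g t, q {x | (x, t) ∈ A}⟫_ℝ ∂m else 0
      empty' := by simp
      not_measurable' := by simp +contextual
      m_iUnion' := by
        intro f hf hd
        rw [if_pos (MeasurableSet.iUnion hf)]
        simp only [hf, ↓reduceIte, HasSum, SummationFilter.unconditional_filter]
        have A (a : Finset ℕ) : ∑ i ∈ a, ∫ t, ⟪g t, q {x | (x, t) ∈ f i}⟫_ℝ ∂m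
            = ∫ t, ⟪g t, q {x | (x, t) ∈ ⋃ i ∈ a, f i}⟫_ℝ ∂m := by
          rw [← integral_finsetSum _ (fun i _ => hint _ (hf i))]
          refine integral_congr_ae (ae_of_all _ fun t => ?_)
          simp only
          rw [← inner_sum, ← VectorMeasure.of_biUnion_finset]
          · congr 2
            ext x
            simp
          · intro i _ j _ hij
            exact (hd hij).preimage (fun x => (x, t))
          · exact fun i _ => measurable_prodMk_right (hf i)
        simp_rw [A]
        refine tendsto_integral_filter_of_dominated_convergence (fun t => ‖g t‖ * q.bound)
          ?_ ?_ (hg.norm.mul_const _) ?_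
        · exact Eventually.of_forall fun a =>
            (hint _ (Finset.measurableSet_biUnion _ fun i _ => hf i)).1
        · refine Eventually.of_forall fun a => ae_of_all _ fun t => ?_
          exact (norm_inner_le_norm _ _).trans
            (mul_le_mul_of_nonneg_left VectorMeasure.norm_apply_le_bound (norm_nonneg _))
        · refine ae_of_all _ fun t => ?_
          refine Tendsto.inner tendsto_const_nhds ?_
          have h1 : HasSum (fun i => q {x | (x, t) ∈ f i}) (q (⋃ i, {x | (x, t) ∈ f i})) :=
            q.hasSum_of_disjoint_iUnion (fun i => measurable_prodMk_right (hf i))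
              (fun i j hij => (hd hij).preimage (fun x => (x, t)))
          have h2 : {x | (x, t) ∈ ⋃ i, f i} = ⋃ i, {x | (x, t) ∈ f i} := by
            ext x
            simp
          rw [h2]
          simp only [HasSum, SummationFilter.unconditional_filter] at h1
          refine h1.congr fun a => ?_
          rw [← VectorMeasure.of_biUnion_finset]
          · congr 1
            ext x
            simp
          · intro i _ j _ hij
            exact (hd hij).preimage (fun x => (x, t))
          · exact fun i _ => measurable_prodMk_right (hf i) }
  have hρ : q.prod (m.withDensityᵥ g) (innerSL ℝ).flip = ρ := by
    refine VectorMeasure.prod_eq_of_forall_apply_prod (fun s t hs ht => ?_)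
    change (if MeasurableSet (s ×ˢ t) then
      ∫ y, ⟪g y, q {x | (x, y) ∈ s ×ˢ t}⟫_ℝ ∂m else 0) = _
    rw [if_pos (hs.prod ht), withDensityᵥ_apply hg ht]
    have : (fun y => ⟪g y, q {x | (x, y) ∈ s ×ˢ t}⟫_ℝ) =
        t.indicator (fun y => ⟪q s, g y⟫_ℝ) := by
      ext y
      by_cases hy : y ∈ t <;> simp [hy, real_inner_comm]
    rw [this, integral_indicator ht, integral_inner hg.integrableOn, ContinuousLinearMap.flip_apply,
      innerSL_apply_apply, real_inner_comm]
  have h1 := VectorMeasure.prod_flip_apply_eq_integral (μ := q) (ν := m.withDensityᵥ g)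
    (B := innerSL ℝ) hS
  rw [hρ] at h1
  change (if MeasurableSet S then ∫ t, ⟪g t, q {x | (x, t) ∈ S}⟫_ℝ ∂m else 0) = _ at h1
  rw [if_pos hS] at h1
  rw [h1]
  congr 1
  ext x
  have := withDensityᵥ_apply hg (measurable_prodMk_left hS : MeasurableSet (Prod.mk x ⁻¹' S))
  rw [this]
  rfl


/-- The open interval `I = (0, T)`. -/
abbrev Interval (T : ℝ) : Type := ↥(Ioo 0 T)

/-- Lebesgue measure on `I = (0, T)`. -/
noncomputable abbrev leb (T : ℝ) : Measure ℝ := volume.restrict (Ioo 0 T)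

/-- The space `𝓜(I; ℝ^d)`; every such measure is finite and regular. -/
abbrev VMeas (T : ℝ) (d : ℕ) : Type := VectorMeasure (Interval T) (Vec d)

/-- The duality pairing `⟨φ, q⟩ = ∫ φ · dq`. -/
noncomputable def pairing {T : ℝ} {d : ℕ} (φ : Interval T → Vec d) (q : VMeas T d) : ℝ :=
  ∫ᵛ s, φ s ∂[innerSL ℝ; q]

/-- `q` is the distributional derivative of `u` on `(0, T)`:
`∫ u · φ' dt = - ⟨φ, q⟩` for all test functions `φ ∈ C_c^∞(I; ℝ^d)`. -/
def IsDistribDeriv {T : ℝ} {d : ℕ} (u : ℝ → Vec d) (q : VMeas T d) : Prop :=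
  ∀ φ : ℝ → Vec d, ContDiff ℝ ∞ φ → HasCompactSupport φ → tsupport φ ⊆ Ioo 0 T →
    ∫ t, ⟪u t, deriv φ t⟫_ℝ ∂leb T = -pairing (fun s : Interval T => φ s) q

/-- `t ↦ ∫_0^t dq`. -/
def primitive {T : ℝ} {d : ℕ} (q : VMeas T d) (t : ℝ) : Vec d := q {s : Interval T | (s : ℝ) ≤ t}

theorem memLp_primitive {T : ℝ} {d : ℕ} (q : VMeas T d) (p : ℝ≥0∞) :
    MemLp (primitive q) p (leb T) := by
  have h : StronglyMeasurable (primitive q) := by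
    have hS : MeasurableSet {z : ℝ × Interval T | (z.2 : ℝ) ≤ z.1} :=
      measurableSet_le (measurable_subtype_coe.comp measurable_snd) measurable_fst
    exact VectorMeasure.stronglyMeasurable_vectorMeasure_prodMk_left (ν := q) hS
  exact MemLp.of_bound h.aestronglyMeasurable q.bound
    (ae_of_all _ fun t => VectorMeasure.norm_apply_le_bound)

theorem isDistribDeriv_primitive {T : ℝ} {d : ℕ} (q : VMeas T d) (c : Vec d) :
    IsDistribDeriv (fun t => primitive q t + c) q := by
  intro φ hφ hc hs
  have hd : Continuous (deriv φ) := hφ.continuous_deriv (by simp)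
  have hz {t : ℝ} (ht : t ∉ Ioo 0 T) : φ t = 0 :=
    image_eq_zero_of_notMem_tsupport fun h => ht (hs h)
  have hg : Integrable (deriv φ) (leb T) :=
    (hd.integrableOn_Icc (a := 0) (b := T)).mono_set Ioo_subset_Icc_self
  have hFTC (a : ℝ) (ha0 : 0 ≤ a) (ha : a ≤ T) :
      ∫ t in Ici a, deriv φ t ∂leb T = - φ a := by
    rw [leb, Measure.restrict_restrict measurableSet_Ici]
    have h0 : (Ioi a ∩ Ioc 0 T : Set ℝ) = Ioc a T := by
      ext x
      simp only [mem_inter_iff, mem_Ioi, mem_Ioc]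
      exact ⟨fun h => ⟨h.1, h.2.2⟩, fun h => ⟨h.1, ha0.trans_lt h.1, h.2⟩⟩
    have h1 : (Ici a ∩ Ioo 0 T : Set ℝ) =ᵐ[volume] Ioc a T :=
      h0 ▸ Ioi_ae_eq_Ici.symm.inter Ioo_ae_eq_Ioc
    have h2 : ∫ t in Ici a ∩ Ioo 0 T, deriv φ t = ∫ t in Ioc a T, deriv φ t :=
      setIntegral_congr_set h1
    rw [h2, ← intervalIntegral.integral_of_le ha, intervalIntegral.integral_deriv_eq_sub'
      φ rfl (fun x _ => (hφ.differentiable (by simp)) x) hd.continuousOn, hz (by simp), zero_sub]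
  have hS : MeasurableSet {z : Interval T × ℝ | (z.1 : ℝ) ≤ z.2} :=
    measurableSet_le (measurable_subtype_coe.comp measurable_fst) measurable_snd
  have key := integral_integral_swap q (leb T) hg hS
  have e1 : (fun x : Interval T => ∫ t in {t | (x, t) ∈ {z : Interval T × ℝ | (z.1 : ℝ) ≤ z.2}},
      deriv φ t ∂leb T) = fun x : Interval T => -φ x := by
    ext1 x
    exact hFTC x x.2.1.le x.2.2.le
  rw [e1] at key
  have e2 : ∫ t, ⟪c, deriv φ t⟫_ℝ ∂leb T = 0 := by
    rw [integral_inner hg]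
    rcases lt_or_ge T 0 with hT | hT
    · simp [leb, Ioo_eq_empty (not_lt.2 hT.le)]
    · have := hFTC 0 le_rfl hT
      rw [hz (by simp), leb, Measure.restrict_restrict measurableSet_Ici,
        inter_eq_right.2 (fun x (hx : x ∈ Ioo 0 T) => mem_Ici.2 hx.1.le)] at this
      rw [this]; simp
  have i1 : Integrable (fun t => ⟪primitive q t, deriv φ t⟫_ℝ) (leb T) := by
    refine (hg.norm.const_mul (q.bound : ℝ)).mono'
      ((memLp_primitive q 1).1.inner hg.1) (ae_of_all _ fun t => ?_)
    exact (norm_inner_le_norm _ _).trans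
      (mul_le_mul_of_nonneg_right VectorMeasure.norm_apply_le_bound (norm_nonneg _))
  simp_rw [inner_add_left]
  rw [integral_add i1 (hg.const_inner c), e2, add_zero]
  have e3 : pairing (fun s : Interval T => φ s) q = - ∫ᵛ x, -φ x ∂[innerSL ℝ; q] := by
    rw [VectorMeasure.integral_fun_neg, neg_neg]; rfl
  rw [e3, key, neg_neg]
  refine integral_congr_ae (ae_of_all _ fun t => ?_)
  exact real_inner_comm _ _

/-- The lemma of du Bois-Reymond on `(0, T)`. -/
theorem exists_ae_eq_const {T : ℝ} {d : ℕ} {w : ℝ → Vec d} (hw : Integrable w (leb T))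
    (h : IsDistribDeriv w (0 : VMeas T d)) : ∃ c, ∀ᵐ t ∂leb T, w t = c := by
  rcases le_or_gt T 0 with hT | hT
  · exact ⟨0, by simp [leb, Ioo_eq_empty (not_lt.2 hT)]⟩
  have hset {g : ℝ → ℝ} (hg : tsupport g ⊆ Ioo 0 T) : ∫ t, g t ∂leb T = ∫ t, g t :=
    setIntegral_eq_integral_of_forall_compl_eq_zero fun t ht =>
      image_eq_zero_of_notMem_tsupport fun h => ht (hg h)
  obtain ⟨η, hηs, hηc, hη, hη1⟩ : ∃ η : ℝ → ℝ, tsupport η ⊆ Ioo 0 T ∧ HasCompactSupport η ∧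
      ContDiff ℝ ∞ η ∧ ∫ t, η t ∂leb T = 1 := by
    let b : ContDiffBump (T / 2) := ⟨T / 8, T / 4, by positivity, by linarith⟩
    have hb : tsupport (b.normed volume) ⊆ Ioo 0 T := by
      rw [b.tsupport_normed_eq]
      intro x hx
      rw [Metric.mem_closedBall, Real.dist_eq, abs_le] at hx
      have h1 : b.rOut = T / 4 := rfl
      rw [h1] at hx
      constructor <;> linarith [hx.1, hx.2]
    exact ⟨b.normed volume, hb, b.hasCompactSupport_normed, b.contDiff_normed, by
      rw [hset hb, b.integral_normed]⟩
  let c : Vec d := ∫ t, η t • w t ∂leb T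
  refine ⟨c, ?_⟩
  have hsm {g : ℝ → ℝ} (hg : ContDiff ℝ ∞ g) (hgc : HasCompactSupport g) :
      Integrable (fun t => g t • w t) (leb T) := by
    obtain ⟨C, hC⟩ := hgc.exists_bound_of_continuous hg.continuous
    exact hw.bdd_smul C hg.continuous.aestronglyMeasurable (ae_of_all _ hC)
  have key : ∀ᵐ t ∂volume, t ∈ Ioo 0 T → w t - c = 0 := by
    refine isOpen_Ioo.ae_eq_zero_of_integral_contDiff_smul_eq_zero
      (IntegrableOn.locallyIntegrableOn (hw.sub (integrable_const c))) ?_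
    intro ψ hψ hψc hψs
    let m : ℝ := ∫ t, ψ t ∂leb T
    let f : ℝ → ℝ := fun t => ψ t - m * η t
    have hf : ContDiff ℝ ∞ f := hψ.sub (contDiff_const.mul hη)
    have hψi : Integrable ψ (leb T) := (hψ.continuous.integrable_of_hasCompactSupport hψc).restrict
    have hηi : Integrable η (leb T) := (hη.continuous.integrable_of_hasCompactSupport hηc).restrict
    have hf0 : ∫ t, f t ∂leb T = 0 := by
      simp only [f]
      rw [integral_sub hψi (hηi.const_mul m), integral_const_mul, hη1, mul_one, sub_self]
    obtain ⟨a, b, ha, hb, hab⟩ : ∃ a b : ℝ, 0 < a ∧ b < T ∧ ∀ t, f t ≠ 0 → t ∈ Icc a b := by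
      have hK : IsCompact (tsupport ψ ∪ tsupport η ∪ {T / 2}) :=
        (IsCompact.union hψc hηc).union isCompact_singleton
      have hne : (tsupport ψ ∪ tsupport η ∪ {T / 2}).Nonempty := ⟨T / 2, by simp⟩
      have hsub : tsupport ψ ∪ tsupport η ∪ {T / 2} ⊆ Ioo 0 T := by
        refine union_subset (union_subset hψs hηs) ?_
        rw [singleton_subset_iff]
        constructor <;> linarith
      obtain ⟨a, haK, ha⟩ := hK.exists_isLeast hne
      obtain ⟨b, hbK, hb⟩ := hK.exists_isGreatest hne
      refine ⟨a, b, (hsub haK).1, (hsub hbK).2, fun t ht => ?_⟩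
      have htK : t ∈ tsupport ψ ∪ tsupport η ∪ {T / 2} := by
        by_contra hcon
        simp only [mem_union, not_or] at hcon
        exact ht (by simp [f, image_eq_zero_of_notMem_tsupport hcon.1.1,
          image_eq_zero_of_notMem_tsupport hcon.1.2])
      exact ⟨ha htK, hb htK⟩
    let P : ℝ → ℝ := fun t => ∫ s in (0 : ℝ)..t, f s
    have hPd (t : ℝ) : HasDerivAt P (f t) t :=
      intervalIntegral.integral_hasDerivAt_right (hf.continuous.intervalIntegrable _ _)
        (hf.continuous.stronglyMeasurableAtFilter _ _) hf.continuous.continuousAt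
    have hfz {t : ℝ} (ht : t ∉ Icc a b) : f t = 0 := by
      by_contra hcon
      exact ht (hab t hcon)
    have hPT : P T = 0 := by
      simp only [P]
      rw [intervalIntegral.integral_of_le hT.le, integral_Ioc_eq_integral_Ioo]
      exact hf0
    have hPz {t : ℝ} (ht : t ∉ Icc a b) : P t = 0 := by
      rcases lt_or_ge t a with h1 | h1
      · refine (intervalIntegral.integral_congr (g := fun _ => (0 : ℝ)) fun s hs => ?_).trans
          (by simp)
        refine hfz fun h2 => ?_
        have := hs.2.trans (max_lt ha h1).le
        have h3 : max 0 t < a := max_lt ha h1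
        exact absurd (hs.2.trans_lt h3) (not_lt.2 h2.1)
      · have h2 : b < t := by
          by_contra hcon
          exact ht ⟨h1, not_lt.1 hcon⟩
        have h3 : P T + ∫ s in T..t, f s = P t :=
          intervalIntegral.integral_add_adjacent_intervals
            (hf.continuous.intervalIntegrable _ _) (hf.continuous.intervalIntegrable _ _)
        rw [← h3, hPT, zero_add]
        refine (intervalIntegral.integral_congr (g := fun _ => (0 : ℝ)) fun s hs => ?_).trans
          (by simp)
        refine hfz fun h4 => ?_
        exact absurd ((lt_min hb h2).trans_le hs.1) (not_lt.2 h4.2)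
    have hP : ContDiff ℝ ∞ P := by
      rw [contDiff_infty_iff_deriv]
      refine ⟨fun t => (hPd t).differentiableAt, ?_⟩
      rw [funext fun t => (hPd t).deriv]
      exact hf
    have hfw : ∫ t, f t • w t ∂leb T = 0 := by
      refine ext_inner_right ℝ fun e => ?_
      have hts : tsupport (fun t => P t • e) ⊆ Icc a b := by
        refine closure_minimal (fun t ht => ?_) isClosed_Icc
        by_contra hcon
        exact ht (by simp [hPz hcon])
      have h1 := h (fun t => P t • e) (hP.smul contDiff_const)
        (IsCompact.of_isClosed_subset isCompact_Icc (isClosed_tsupport _) hts)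
        (hts.trans (Icc_subset_Ioo ha hb))
      have h2 (t : ℝ) : deriv (fun t => P t • e) t = f t • e := ((hPd t).smul_const e).deriv
      simp only [h2, pairing, VectorMeasure.integral_zero_vectorMeasure, neg_zero] at h1
      have hfi : Integrable (fun t => f t • w t) (leb T) := by
        have := (hsm hψ hψc).sub ((hsm hη hηc).smul m)
        refine this.congr (ae_of_all _ fun t => ?_)
        simp [f, sub_smul, mul_smul]
      rw [inner_zero_left, real_inner_comm, ← integral_inner hfi e, ← h1]
      refine integral_congr_ae (ae_of_all _ fun t => ?_)
      change ⟪e, f t • w t⟫_ℝ = ⟪w t, f t • e⟫_ℝ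
      rw [real_inner_smul_right, real_inner_smul_right, real_inner_comm]
    have h3 : ∫ t, ψ t • (w t - c) = ∫ t, ψ t • (w t - c) ∂leb T :=
      (setIntegral_eq_integral_of_forall_compl_eq_zero fun t ht => by
        rw [image_eq_zero_of_notMem_tsupport fun h => ht (hψs h), zero_smul]).symm
    rw [h3]
    simp_rw [smul_sub]
    rw [integral_sub (hsm hψ hψc) (hψi.smul_const c), integral_smul_const]
    have h4 : ∫ t, f t • w t ∂leb T = ∫ t, ψ t • w t ∂leb T - m • c := by
      simp only [f, sub_smul, mul_smul]
      have hm : Integrable (fun t => m • η t • w t) (leb T) := (hsm hη hηc).smul m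
      rw [integral_sub (hsm hψ hψc) hm, integral_smul]
    exact h4.symm.trans hfw
  filter_upwards [(ae_restrict_iff' measurableSet_Ioo).2 key] with t ht
  exact sub_eq_zero.1 ht

theorem IsDistribDeriv.sub {T : ℝ} {d : ℕ} {u v : ℝ → Vec d} {q r : VMeas T d}
    (hu : Integrable u (leb T)) (hv : Integrable v (leb T))
    (h : IsDistribDeriv u q) (h' : IsDistribDeriv v r) :
    IsDistribDeriv (fun t => u t - v t) (q - r) := by
  intro φ hφ hc hs
  have hd : Continuous (deriv φ) := hφ.continuous_deriv (by simp)
  obtain ⟨C, hC⟩ := hc.deriv.exists_bound_of_continuous hd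
  obtain ⟨C', hC'⟩ := hc.exists_bound_of_continuous hφ.continuous
  have hi {v : ℝ → Vec d} (hv : Integrable v (leb T)) :
      Integrable (fun t => ⟪v t, deriv φ t⟫_ℝ) (leb T) := by
    refine (hv.norm.mul_const C).mono' (hv.1.inner hd.aestronglyMeasurable)
      (ae_of_all _ fun t => (norm_inner_le_norm _ _).trans ?_)
    exact mul_le_mul_of_nonneg_left (hC t) (norm_nonneg _)
  have hj (q : VMeas T d) : q.Integrable (fun s : Interval T => φ s) := by
    have := isFiniteMeasure_variation q
    exact Integrable.of_bound (hφ.continuous.comp continuous_subtype_val).aestronglyMeasurable C'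
      (ae_of_all _ fun s => hC' s)
  simp_rw [inner_sub_left]
  rw [integral_sub (hi hu) (hi hv), h φ hφ hc hs, h' φ hφ hc hs]
  simp only [pairing]
  rw [VectorMeasure.integral_sub_vectorMeasure (hj q) (hj r)]
  ring

/-- The distributional derivative is unique. -/
theorem IsDistribDeriv.unique {T : ℝ} {d : ℕ} {u : ℝ → Vec d} {q r : VMeas T d}
    (hu : Integrable u (leb T)) (h : IsDistribDeriv u q) (h' : IsDistribDeriv u r) : q = r := by
  rcases le_or_gt T 0 with hT | hT
  · have : IsEmpty (Interval T) := ⟨fun s => absurd (s.2.1.trans s.2.2) (not_lt.2 hT)⟩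
    ext s _
    simp [eq_empty_of_isEmpty s]
  suffices H : q - r = 0 from sub_eq_zero.1 H
  set m : VMeas T d := q - r with hm
  have hp : Integrable (primitive m) (leb T) := memLp_one_iff_integrable.1 (memLp_primitive m 1)
  have h1 : IsDistribDeriv (fun t => primitive m t) (0 : VMeas T d) := by
    have h2 := (isDistribDeriv_primitive m 0).sub (by simpa using hp) (hu.sub hu) (h.sub hu hu h')
    simpa [← hm] using h2
  obtain ⟨c, hc⟩ := exists_ae_eq_const hp h1
  have hD : Dense {t : ℝ | t ∈ Ioo 0 T → primitive m t = c} :=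
    Measure.dense_of_ae ((ae_restrict_iff' measurableSet_Ioo).1 hc)
  have hms (t : ℝ) : MeasurableSet {s : Interval T | (s : ℝ) ≤ t} :=
    measurableSet_le measurable_subtype_coe measurable_const
  have hR (t : ℝ) (h0 : 0 ≤ t) (hlt : t < T) : m {s : Interval T | (s : ℝ) ≤ t} = c := by
    obtain ⟨u, hu1, hu2, hu3⟩ := hD.exists_seq_strictAnti_tendsto_of_lt hlt
    have h3 := VectorMeasure.tendsto_vectorMeasure_iInter_atTop_nat (v := m)
      (s := fun n => {s : Interval T | (s : ℝ) ≤ u n})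
      (fun i j hij s hs => le_trans hs (hu1.antitone hij)) (fun n => hms _)
    have h4 : (⋂ n, {s : Interval T | (s : ℝ) ≤ u n}) = {s : Interval T | (s : ℝ) ≤ t} := by
      ext s
      simp only [mem_iInter, mem_ofPred_eq]
      exact ⟨fun h => ge_of_tendsto' hu3 h, fun h n => h.trans (hu2 n).1.1.le⟩
    rw [h4] at h3
    refine tendsto_nhds_unique h3 ?_
    refine tendsto_const_nhds.congr fun n => ?_
    exact ((hu2 n).2 ⟨h0.trans_lt (hu2 n).1.1, (hu2 n).1.2⟩).symm
  have hc0 : c = 0 := by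
    rw [← hR 0 le_rfl hT]
    have : {s : Interval T | (s : ℝ) ≤ 0} = ∅ := by
      ext s
      simpa using s.2.1
    rw [this, VectorMeasure.empty]
  have huniv : m univ = 0 := by
    obtain ⟨u, hu1, hu2, hu3⟩ := exists_seq_strictMono_tendsto' hT
    have h3 := VectorMeasure.tendsto_vectorMeasure_iUnion_atTop_nat (v := m)
      (s := fun n => {s : Interval T | (s : ℝ) ≤ u n})
      (fun i j hij s hs => le_trans hs (hu1.monotone hij)) (fun n => hms _)
    have h4 : (⋃ n, {s : Interval T | (s : ℝ) ≤ u n}) = univ := by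
      refine eq_univ_of_forall fun s => ?_
      obtain ⟨n, hn⟩ := (hu3.eventually_const_le s.2.2).exists
      exact mem_iUnion.2 ⟨n, hn⟩
    rw [h4] at h3
    refine tendsto_nhds_unique h3 ?_
    refine tendsto_const_nhds.congr fun n => ?_
    rw [hR (u n) (hu2 n).1.le (hu2 n).2, hc0]
  refine VectorMeasure.ext_of_generateFrom (range Iic) ?_
    ((BorelSpace.measurable_eq (α := Interval T)).trans (borel_eq_generateFrom_Iic _)) isPiSystem_Iic
    (by simpa using huniv)
  rintro _ ⟨s, rfl⟩
  exact (hR s s.2.1.le s.2.2).trans (by simp [hc0])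

/-- The embedding of `BV(I; ℝ^d)` into `L²(I; ℝ^d)`. -/
theorem IsDistribDeriv.memLp_two {T : ℝ} {d : ℕ} {u : ℝ → Vec d} {q : VMeas T d}
    (hu : Integrable u (leb T)) (h : IsDistribDeriv u q) : MemLp u 2 (leb T) := by
  have hq : Integrable (primitive q) (leb T) := memLp_one_iff_integrable.1 (memLp_primitive q 1)
  have h0 : IsDistribDeriv (fun t => u t - primitive q t) (0 : VMeas T d) := by
    have h1 := h.sub hu (by simpa using hq) (isDistribDeriv_primitive q 0)
    simpa using h1
  obtain ⟨c, hc⟩ := exists_ae_eq_const (hu.sub hq) h0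
  refine ((memLp_primitive q 2).add (memLp_const c)).ae_eq ?_
  filter_upwards [hc] with t ht
  simp only [Pi.add_apply, ← ht, Pi.sub_apply]
  abel
/-- `BV(I; ℝ^d)`: the `L¹` functions whose distributional derivative is a measure. -/
def BV (T : ℝ) (d : ℕ) : Set (Lp (Vec d) 1 (leb T)) :=
  {u | ∃ q : VMeas T d, IsDistribDeriv u q}

/-- The distributional derivative `u'`; it is unique by `IsDistribDeriv.unique`. -/
noncomputable def BV.deriv {T : ℝ} {d : ℕ} (u : BV T d) : VMeas T d := u.2.choose

/-- A function of bounded variation as an element of `L²(I; ℝ^d)`. -/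
noncomputable def BV.toL2 {T : ℝ} {d : ℕ} (u : BV T d) : Lp (Vec d) 2 (leb T) :=
  (u.2.choose_spec.memLp_two (L1.integrable_coeFn u.1)).toLp u.1

/-- The norm of `𝓜(I; ℝ^d)` as the dual norm of `C₀(I; ℝ^d)`. -/
noncomputable def mnorm {T : ℝ} {d : ℕ} (q : VMeas T d) : ℝ :=
  sSup {r | ∃ φ : C₀(Interval T, Vec d), ‖φ‖ = 1 ∧ r = pairing φ q}

/-- The norm `‖u‖_BV = ‖u'‖_𝓜 + ‖u‖_{L¹}`. -/
noncomputable def bvNorm {T : ℝ} {d : ℕ} (u : BV T d) : ℝ := mnorm (BV.deriv u) + ‖u.1‖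

/-- The supremum norm `‖φ‖_C = sup_{t ∈ I} |φ(t)|`. -/
noncomputable def cnorm {T : ℝ} {d : ℕ} (φ : Interval T → Vec d) : ℝ := ⨆ t, ‖φ t‖

/-- `B(q, c) = ∫_0^· dq - (1/T) ∫_0^T ∫_0^s dq ds + c` as a pointwise defined function. -/
noncomputable def bvFun {T : ℝ} {d : ℕ} (q : VMeas T d) (c : Vec d) (t : ℝ) : Vec d :=
  primitive q t - T⁻¹ • (∫ s, primitive q s ∂leb T) + c

theorem memLp_bvFun {T : ℝ} {d : ℕ} (q : VMeas T d) (c : Vec d) :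
    MemLp (bvFun q c) 1 (leb T) :=
  ((memLp_primitive q 1).sub (memLp_const _)).add (memLp_const c)

theorem isDistribDeriv_bvFun {T : ℝ} {d : ℕ} (q : VMeas T d) (c : Vec d) :
    IsDistribDeriv ((memLp_bvFun q c).toLp (bvFun q c)) q := by
  intro φ hφ hc hs
  rw [← isDistribDeriv_primitive q (-(T⁻¹ • ∫ s, primitive q s ∂leb T) + c) φ hφ hc hs]
  refine integral_congr_ae ?_
  filter_upwards [(memLp_bvFun q c).coeFn_toLp] with t ht
  rw [ht, bvFun, sub_eq_add_neg, add_assoc]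

/-- The operator `B : 𝓜(I; ℝ^d) × ℝ^d → BV(I; ℝ^d)`. -/
noncomputable def bvOf {T : ℝ} {d : ℕ} (q : VMeas T d) (c : Vec d) : BV T d :=
  ⟨(memLp_bvFun q c).toLp (bvFun q c), q, isDistribDeriv_bvFun q c⟩

/-- A jump `v = 𝐯 δ_t` with position `t ∈ I` and direction `|𝐯| = 1`. -/
structure Jump (T : ℝ) (d : ℕ) where
  pos : Interval T
  dir : Vec d
  norm_dir : ‖dir‖ = 1

/-- The measure `𝐯 δ_t`. -/
noncomputable def Jump.measure {T : ℝ} {d : ℕ} (v : Jump T d) : VMeas T d :=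
  VectorMeasure.dirac v.pos v.dir

/-- The measure `∑ μ_i v_i`. -/
noncomputable def jumpSum {T : ℝ} {d N : ℕ} (v : Fin N → Jump T d) (μ : Fin N → ℝ) : VMeas T d :=
  ∑ i, μ i • (v i).measure

/-- A finite active set `{(μ_i, v_i)}_{i = 1, …, N}` with positive magnitudes. -/
structure ActiveSet (T : ℝ) (d : ℕ) where
  card : ℕ
  weight : Fin card → ℝ
  jump : Fin card → Jump T d
  weight_pos : ∀ i, 0 < weight i

/-- The function `B(∑ μ_i v_i, c)` given by an active set and an offset. -/
noncomputable def ActiveSet.iterate {T : ℝ} {d : ℕ} (A : ActiveSet T d) (c : Vec d) : BV T d :=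
  bvOf (jumpSum A.jump A.weight) c

/-- `A` consists of those pairs `(μ_i, v_i)` with `μ_i > 0`, in any enumeration. -/
def IsPruned {T : ℝ} {d N : ℕ} (v : Fin N → Jump T d) (μ : Fin N → ℝ) (A : ActiveSet T d) : Prop :=
  ∃ e : Fin A.card ≃ {i : Fin N // 0 < μ i},
    ∀ i, A.weight i = μ (e i) ∧ A.jump i = v (e i)

/-- `v` is a candidate jump `(p(t) / ‖p‖_C) δ_t` at a global maximizer `t` of `|p|`. -/
def IsCandidate {T : ℝ} {d : ℕ} (p : Interval T → Vec d) (v : Jump T d) : Prop :=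
  0 < cnorm p ∧ ‖p v.pos‖ = cnorm p ∧ v.dir = (cnorm p)⁻¹ • p v.pos

section Problem

variable {T : ℝ} {d : ℕ} {Y : Type*} [NormedAddCommGroup Y] [InnerProductSpace ℝ Y]

/-- The objective `j(u) = F(Ku) + β ‖u'‖_𝓜`. -/
noncomputable def objective (K : Lp (Vec d) 2 (leb T) →L[ℝ] Y) (F : Y → ℝ) (β : ℝ)
    (u : BV T d) : ℝ :=
  F (K (BV.toL2 u)) + β * mnorm (BV.deriv u)

/-- `u` minimizes `j` over `BV(I; ℝ^d)`. -/
def IsMinimizer (K : Lp (Vec d) 2 (leb T) →L[ℝ] Y) (F : Y → ℝ) (β : ℝ) (u : BV T d) : Prop :=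
  ∀ w : BV T d, objective K F β u ≤ objective K F β w

/-- `F(K B(∑ μ_i v_i, c)) + β ∑ μ_i`. -/
noncomputable def subObjective (K : Lp (Vec d) 2 (leb T) →L[ℝ] Y) (F : Y → ℝ) (β : ℝ) {N : ℕ}
    (v : Fin N → Jump T d) (μ : Fin N → ℝ) (c : Vec d) : ℝ :=
  F (K (BV.toL2 (bvOf (jumpSum v μ) c))) + β * ∑ i, μ i

/-- `(μ, c)` solves the finite-dimensional subproblem over `μ ≥ 0` and `c ∈ ℝ^d`. -/
def IsSubMinimizer (K : Lp (Vec d) 2 (leb T) →L[ℝ] Y) (F : Y → ℝ) (β : ℝ) {N : ℕ}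
    (v : Fin N → Jump T d) (μ : Fin N → ℝ) (c : Vec d) : Prop :=
  (∀ i, 0 ≤ μ i) ∧ ∀ (μ' : Fin N → ℝ) (c' : Vec d), (∀ i, 0 ≤ μ' i) →
    subObjective K F β v μ c ≤ subObjective K F β v μ' c'

/-- The dual variable `p(t) = ∫_0^t K* ∇F(Ku) ds` on `I`. -/
noncomputable def dualVar [CompleteSpace Y] (K : Lp (Vec d) 2 (leb T) →L[ℝ] Y) (F : Y → ℝ)
    (u : BV T d) (t : Interval T) : Vec d :=
  ∫ s in (0 : ℝ)..t, (ContinuousLinearMap.adjoint K (gradient F (K (BV.toL2 u)))) s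

/-- The sequences `A_k`, `c_k` (`0 ≤ k ≤ n`) are generated by the primal-dual-active-jump method
from the initial active set `A_0`; `n = ⊤` stands for a run that never terminates. A further step
after iteration `k` is made only if the stopping criterion `‖p_k‖_C ≤ β` fails. -/
structure IsRun [CompleteSpace Y] (K : Lp (Vec d) 2 (leb T) →L[ℝ] Y) (F : Y → ℝ) (β : ℝ)
    (n : ℕ∞) (A : ℕ → ActiveSet T d) (c : ℕ → Vec d) : Prop where
  init : ∃ μ : Fin (A 0).card → ℝ,
    IsSubMinimizer K F β (A 0).jump μ (c 1) ∧ IsPruned (A 0).jump μ (A 1)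
  step : ∀ k : ℕ, 1 ≤ k → (k : ℕ∞) < n →
    β < cnorm (dualVar K F ((A k).iterate (c k))) ∧
    ∃ vhat : Jump T d, IsCandidate (dualVar K F ((A k).iterate (c k))) vhat ∧
      ∃ μ : Fin ((A k).card + 1) → ℝ,
        IsSubMinimizer K F β (Fin.snoc (A k).jump vhat) μ (c (k + 1)) ∧
        IsPruned (Fin.snoc (A k).jump vhat) μ (A (k + 1))

end Problem

end PDAJ

open PDAJ

/-! Write f = K*∇F(Ku), so that p is the potential of f. Everything follows from the first-order
conditions of the subproblem that produced u. The offset c is free, so f has mean zero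
(`IsSubMinimizer.integral_eq_zero`); hence p vanishes at both ends of the interval and lies in C₀
(`exists_zeroAtInfty_eq_potential`). Mean zero also gives integration by parts without boundary
terms, (f, w) = -⟨p, w'⟩ for every w in BV (`inner_toL2`). Differentiating the subproblem in a
positive magnitude therefore yields ⟨p, v_i⟩ = β (`IsSubMinimizer.inner_dualVar_eq`), and summation
gives ⟨p, u'⟩ = β ∑ μ_i.

If ‖p‖ ≤ β, convexity and integration by parts give F(Kw) - F(Ku) ≥ ⟨p, u'⟩ - ⟨p, w'⟩ ≥ β‖u'‖ -
β‖w'‖, which is minimality (`isMinimizer_of_norm_le`). The lower bound ‖p‖ ≥ β is Cauchy-Schwarz at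
an active jump, and a candidate that is already active pairs with p both to ‖p‖ and to β. -/

namespace PDAJ

/-! ### Derivatives of BV functions and linearity of B. -/

section BoundedVariation

variable {T : ℝ} {d : ℕ}

/-- `BV.deriv` is an arbitrary choice of witness; uniqueness of the distributional derivative makes
it computable. -/
theorem deriv_eq_of_isDistribDeriv (w : BV T d) {q : VMeas T d} (h : IsDistribDeriv w.1 q) :
    BV.deriv w = q :=
  IsDistribDeriv.unique (L1.integrable_coeFn w.1) w.2.choose_spec h

theorem isDistribDeriv_deriv (w : BV T d) : IsDistribDeriv w.1 (BV.deriv w) :=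
  w.2.choose_spec

theorem deriv_bvOf (q : VMeas T d) (c : Vec d) : BV.deriv (bvOf q c) = q :=
  deriv_eq_of_isDistribDeriv _ (isDistribDeriv_bvFun q c)

theorem coeFn_toL2 (w : BV T d) : ⇑(BV.toL2 w) =ᵐ[leb T] ⇑w.1 :=
  MemLp.coeFn_toLp _

theorem coeFn_toL2_bvOf (q : VMeas T d) (c : Vec d) :
    ⇑(BV.toL2 (bvOf q c)) =ᵐ[leb T] bvFun q c :=
  (coeFn_toL2 _).trans (memLp_bvFun q c).coeFn_toLp

theorem integrable_primitive (q : VMeas T d) : Integrable (primitive q) (leb T) :=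
  memLp_one_iff_integrable.1 (memLp_primitive q 1)

theorem primitive_add_smul (q r : VMeas T d) (s t : ℝ) :
    primitive (q + s • r) t = primitive q t + s • primitive r t := by
  simp [primitive]

theorem bvFun_add_smul (q r : VMeas T d) (c e : Vec d) (s t : ℝ) :
    bvFun (q + s • r) (c + s • e) t = bvFun q c t + s • bvFun r e t := by
  simp only [bvFun, primitive_add_smul]
  have h : ∫ t, (primitive q t + s • primitive r t) ∂leb T =
      ∫ t, primitive q t ∂leb T + s • ∫ t, primitive r t ∂leb T := by
    rw [← integral_smul]
    exact integral_add (integrable_primitive q) ((integrable_primitive r).smul s)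
  rw [h]
  module

/-- Variations of the magnitudes and of the offset thus move the state along a line in L², where F ∘
K can be differentiated. -/
theorem toL2_bvOf_add_smul (q r : VMeas T d) (c e : Vec d) (s : ℝ) :
    BV.toL2 (bvOf (q + s • r) (c + s • e)) = BV.toL2 (bvOf q c) + s • BV.toL2 (bvOf r e) := by
  refine Lp.ext ?_
  filter_upwards [coeFn_toL2_bvOf (q + s • r) (c + s • e), coeFn_toL2_bvOf q c,
    coeFn_toL2_bvOf r e, Lp.coeFn_add (BV.toL2 (bvOf q c)) (s • BV.toL2 (bvOf r e)),
    Lp.coeFn_smul s (BV.toL2 (bvOf r e))] with t h1 h2 h3 h4 h5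
  rw [h1, h4, Pi.add_apply, h5, Pi.smul_apply, h2, h3, bvFun_add_smul]

/-- A function of bounded variation is a primitive of its derivative. -/
theorem exists_coeFn_toL2_eq_primitive_add (w : BV T d) :
    ∃ c : Vec d, ⇑(BV.toL2 w) =ᵐ[leb T] fun t => primitive (BV.deriv w) t + c := by
  have hw := L1.integrable_coeFn w.1
  have h : IsDistribDeriv (fun t => w.1 t - primitive (BV.deriv w) t) (0 : VMeas T d) := by
    simpa using (isDistribDeriv_deriv w).sub hw
      (by simpa using integrable_primitive (BV.deriv w))
      (isDistribDeriv_primitive (BV.deriv w) 0)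
  obtain ⟨c, hc⟩ := exists_ae_eq_const (hw.sub (integrable_primitive (BV.deriv w)))
    h
  refine ⟨c, ?_⟩
  filter_upwards [hc, coeFn_toL2 w] with t h1 h2
  rw [h2, ← h1, Pi.sub_apply]
  abel

end BoundedVariation

/-! ### The pairing of C₀ with measures and the dual norm. -/

section Pairing

variable {T : ℝ} {d : ℕ}

theorem integrable_of_zeroAtInfty (q : VMeas T d) (φ : C₀(Interval T, Vec d)) :
    q.Integrable φ := by
  have := isFiniteMeasure_variation q
  exact Integrable.of_bound (map_continuous φ).aestronglyMeasurable ‖φ‖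
    (ae_of_all _ fun s => φ.toBCF.norm_coe_le_norm s)

theorem norm_apply_le_norm (φ : C₀(Interval T, Vec d)) (t : Interval T) : ‖φ t‖ ≤ ‖φ‖ :=
  φ.toBCF.norm_coe_le_norm t

theorem cnorm_eq_norm (φ : C₀(Interval T, Vec d)) : cnorm φ = ‖φ‖ :=
  (φ.toBCF.norm_eq_iSup_norm).symm

theorem pairing_measure (φ : Interval T → Vec d) (v : Jump T d) :
    pairing φ v.measure = ⟪φ v.pos, v.dir⟫_ℝ :=
  VectorMeasure.integral_dirac

theorem pairing_jumpSum (φ : C₀(Interval T, Vec d)) {N : ℕ} (v : Fin N → Jump T d)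
    (μ : Fin N → ℝ) : pairing φ (jumpSum v μ) = ∑ i, μ i * ⟪φ (v i).pos, (v i).dir⟫_ℝ := by
  rw [pairing, jumpSum, VectorMeasure.integral_finsetSum_vectorMeasure
    fun i _ => integrable_of_zeroAtInfty _ φ]
  refine Finset.sum_congr rfl fun i _ => ?_
  rw [VectorMeasure.integral_smul_vectorMeasure, smul_eq_mul]
  exact congrArg _ (pairing_measure φ (v i))

theorem pairing_smul (a : ℝ) (φ : Interval T → Vec d) (q : VMeas T d) :
    pairing (a • φ) q = a * pairing φ q :=
  VectorMeasure.integral_smul _ _ _ a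

/-- Finite total variation bounds the pairings. Without this the real supremum in `mnorm` could be
the default value 0. -/
theorem bddAbove_pairing (q : VMeas T d) :
    BddAbove {r | ∃ φ : C₀(Interval T, Vec d), ‖φ‖ = 1 ∧ r = pairing φ q} := by
  have := isFiniteMeasure_variation q
  refine ⟨1 * ‖innerSL ℝ (E := Vec d)‖ * q.variation.real univ, ?_⟩
  rintro _ ⟨φ, hφ, rfl⟩
  refine (Real.le_norm_self _).trans (VectorMeasure.norm_integral_le_of_norm_le_const ?_)
  exact ae_of_all _ fun x => (norm_apply_le_norm φ x).trans hφ.le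

theorem mnorm_nonneg (q : VMeas T d) : 0 ≤ mnorm q := by
  by_cases h : ∃ φ : C₀(Interval T, Vec d), ‖φ‖ = 1
  · obtain ⟨φ, hφ⟩ := h
    have h1 : pairing φ q ≤ mnorm q := le_csSup (bddAbove_pairing q) ⟨φ, hφ, rfl⟩
    have h2 : pairing ((-1 : ℝ) • ⇑φ) q ≤ mnorm q :=
      le_csSup (bddAbove_pairing q) ⟨(-1 : ℝ) • φ, by rw [norm_smul, hφ]; simp, rfl⟩
    rw [pairing_smul] at h2
    linarith
  -- Unit test functions are missing when d = 0 or the interval is empty; the supremum of the empty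
  -- set is 0 by convention.
  · have he : {r | ∃ φ : C₀(Interval T, Vec d), ‖φ‖ = 1 ∧ r = pairing φ q} = ∅ :=
      eq_empty_of_forall_notMem fun r ⟨φ, hφ, _⟩ => h ⟨φ, hφ⟩
    rw [mnorm, he, Real.sSup_empty]

theorem pairing_le (φ : C₀(Interval T, Vec d)) (q : VMeas T d) :
    pairing φ q ≤ ‖φ‖ * mnorm q := by
  rcases eq_or_ne φ 0 with rfl | hφ
  · simp [pairing]
  have hn : 0 < ‖φ‖ := norm_pos_iff.2 hφ
  have h : pairing (‖φ‖⁻¹ • ⇑φ) q ≤ mnorm q := le_csSup (bddAbove_pairing q)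
    ⟨‖φ‖⁻¹ • φ, by rw [norm_smul, norm_inv, norm_norm, inv_mul_cancel₀ hn.ne'], rfl⟩
  rwa [pairing_smul, inv_mul_le_iff₀ hn] at h

/-- Triangle inequality for unit jumps. Equality can fail, since jumps at the same position with
different directions partly cancel; only this direction is needed for optimality. -/
theorem mnorm_jumpSum_le {N : ℕ} (v : Fin N → Jump T d) {μ : Fin N → ℝ} (hμ : ∀ i, 0 ≤ μ i) :
    mnorm (jumpSum v μ) ≤ ∑ i, μ i := by
  refine Real.sSup_le ?_ (Finset.sum_nonneg fun i _ => hμ i)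
  rintro _ ⟨φ, hφ, rfl⟩
  rw [pairing_jumpSum]
  refine Finset.sum_le_sum fun i _ => mul_le_of_le_one_right (hμ i) ?_
  refine (real_inner_le_norm _ _).trans ?_
  rw [(v i).norm_dir, mul_one]
  exact (norm_apply_le_norm φ _).trans hφ.le

end Pairing

/-! ### Potentials of mean-zero functions and integration by parts. -/

section Potential

variable {T : ℝ} {d : ℕ} {g : ℝ → Vec d}

theorem intervalIntegrable_of_integrable_leb (hg : Integrable g (leb T)) {a b : ℝ}
    (ha : a ∈ Icc 0 T) (hb : b ∈ Icc 0 T) : IntervalIntegrable g volume a b := by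
  rw [intervalIntegrable_iff]
  refine IntegrableOn.mono_set ((integrableOn_Icc_iff_integrableOn_Ioo (μ := volume)).2 hg) ?_
  exact uIoc_subset_uIcc.trans (uIcc_subset_Icc ha hb)

theorem intervalIntegral_eq_integral_leb (hT : 0 ≤ T) :
    ∫ s in (0 : ℝ)..T, g s = ∫ s, g s ∂leb T := by
  rw [intervalIntegral.integral_of_le hT, integral_Ioc_eq_integral_Ioo]

theorem continuousOn_potential (hT : 0 ≤ T) (hg : Integrable g (leb T)) :
    ContinuousOn (fun t => ∫ s in (0 : ℝ)..t, g s) (Icc 0 T) := by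
  have h := (integrableOn_Icc_iff_integrableOn_Ioo (μ := volume)).2 hg
  rw [← uIcc_of_le hT] at h ⊢
  exact intervalIntegral.continuousOn_primitive_interval h

/-- The primitive of a function with vanishing mean belongs to `C₀(I; ℝ^d)`. -/
theorem exists_zeroAtInfty_eq_potential (hT : 0 ≤ T) (hg : Integrable g (leb T))
    (h0 : ∫ s, g s ∂leb T = 0) :
    ∃ P : C₀(Interval T, Vec d), ⇑P = fun t : Interval T => ∫ s in (0 : ℝ)..t, g s := by
  have hc := continuousOn_potential hT hg
  refine ⟨⟨⟨fun t : Interval T => ∫ s in (0 : ℝ)..t, g s, ?_⟩, ?_⟩, rfl⟩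
  · exact continuousOn_iff_continuous_domRestrict.1 (hc.mono Ioo_subset_Icc_self)
  · rw [Metric.tendsto_nhds]
    intro ε hε
    -- The superlevel set is compact in the closed interval and avoids both endpoints, where the
    -- potential is zero; so it is compact in the open interval.
    have hK : IsCompact {t ∈ Icc 0 T | ε ≤ ‖∫ s in (0 : ℝ)..t, g s‖} :=
      isCompact_Icc.of_isClosed_subset
        (hc.norm.preimage_isClosed_of_isClosed isClosed_Icc isClosed_Ici) fun t ht => ht.1
    have hsub : {t ∈ Icc 0 T | ε ≤ ‖∫ s in (0 : ℝ)..t, g s‖} ⊆ Ioo 0 T := by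
      rintro t ⟨ht, hε'⟩
      refine ⟨ht.1.lt_of_ne ?_, ht.2.lt_of_ne ?_⟩
      · rintro rfl
        simp at hε'
        linarith
      · rintro rfl
        rw [intervalIntegral_eq_integral_leb ht.1, h0, norm_zero] at hε'
        linarith
    have hK' : IsCompact {t : Interval T | ε ≤ ‖∫ s in (0 : ℝ)..t, g s‖} := by
      rw [Subtype.isCompact_iff]
      convert hK using 1
      ext t
      constructor
      · rintro ⟨s, hs, rfl⟩
        exact ⟨Ioo_subset_Icc_self s.2, hs⟩
      · exact fun h => ⟨⟨t, hsub h⟩, h.2, rfl⟩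
    filter_upwards [hK'.compl_mem_cocompact] with t ht
    simpa using ht

/-- Fubini on {x ≤ t} turns the left side into the pairing of q with x ↦ ∫_x^T g, and mean zero
makes this function -∫_0^x g. -/
theorem integral_inner_primitive (hT : 0 < T) (hg : Integrable g (leb T))
    (h0 : ∫ s, g s ∂leb T = 0) (q : VMeas T d) :
    ∫ t, ⟪g t, primitive q t⟫_ℝ ∂leb T =
      -pairing (fun t : Interval T => ∫ s in (0 : ℝ)..t, g s) q := by
  have hS : MeasurableSet {z : Interval T × ℝ | (z.1 : ℝ) ≤ z.2} :=
    measurableSet_le (measurable_subtype_coe.comp measurable_fst) measurable_snd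
  refine (integral_integral_swap q (leb T) hg hS).symm.trans ?_
  rw [pairing, ← VectorMeasure.integral_fun_neg]
  congr 1
  ext1 x
  have hx := Ioo_subset_Icc_self x.2
  have h1 : ∫ t in Ici (x : ℝ), g t ∂leb T = ∫ t in (x : ℝ)..T, g t := by
    rw [leb, Measure.restrict_restrict measurableSet_Ici,
      intervalIntegral.integral_of_le hx.2, integral_Ioc_eq_integral_Ioo,
      ← integral_Ico_eq_integral_Ioo]
    congr 2
    ext t
    exact ⟨fun h => ⟨h.1, h.2.2⟩, fun h => ⟨h.1, x.2.1.trans_le h.1, h.2⟩⟩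
  have h2 := intervalIntegral.integral_add_adjacent_intervals
    (intervalIntegrable_of_integrable_leb hg (left_mem_Icc.2 hT.le) hx)
    (intervalIntegrable_of_integrable_leb hg hx (right_mem_Icc.2 hT.le))
  rw [intervalIntegral_eq_integral_leb hT.le, h0] at h2
  exact h1.trans (eq_neg_of_add_eq_zero_right h2)

/-- A BV function is a primitive of its derivative plus a constant, and f is orthogonal to
constants. This turns L² derivatives of F ∘ K into pairings with p. -/
theorem inner_toL2 (hT : 0 < T) (f : Lp (Vec d) 2 (leb T)) (h0 : ∫ s, f s ∂leb T = 0)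
    (w : BV T d) : ⟪f, BV.toL2 w⟫_ℝ =
      -pairing (fun t : Interval T => ∫ s in (0 : ℝ)..t, f s) (BV.deriv w) := by
  have hf : Integrable f (leb T) := (Lp.memLp f).integrable one_le_two
  obtain ⟨c, hc⟩ := exists_coeFn_toL2_eq_primitive_add w
  have h1 : ∫ t, ⟪f t, c⟫_ℝ ∂leb T = 0 := by
    simp_rw [real_inner_comm c]
    rw [integral_inner hf, h0, inner_zero_right]
  have h2 : Integrable (fun t => ⟪f t, primitive (BV.deriv w) t⟫_ℝ) (leb T) :=
    (hf.norm.mul_const (BV.deriv w).bound).mono' (hf.1.inner (integrable_primitive _).1)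
      (ae_of_all _ fun t => (norm_inner_le_norm _ _).trans
        (mul_le_mul_of_nonneg_left VectorMeasure.norm_apply_le_bound (norm_nonneg _)))
  rw [L2.inner_def, ← integral_inner_primitive hT hf h0]
  calc ∫ t, ⟪f t, BV.toL2 w t⟫_ℝ ∂leb T
      = ∫ t, (⟪f t, primitive (BV.deriv w) t⟫_ℝ + ⟪f t, c⟫_ℝ) ∂leb T := by
        refine integral_congr_ae ?_
        filter_upwards [hc] with t ht
        rw [ht, inner_add_right]
    _ = _ := by rw [integral_add h2 (hf.inner_const c), h1, add_zero]

end Potential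

/-! ### Optimality conditions of the subproblem and of the full problem. -/

section Optimality

variable {T : ℝ} {d : ℕ} {Y : Type*} [NormedAddCommGroup Y] [InnerProductSpace ℝ Y]
  [CompleteSpace Y] {K : Lp (Vec d) 2 (leb T) →L[ℝ] Y} {F : Y → ℝ} {β : ℝ}

theorem hasDerivAt_comp_add_smul {F : Y → ℝ} (hF : ContDiff ℝ 1 F)
    (K : Lp (Vec d) 2 (leb T) →L[ℝ] Y) (x y : Lp (Vec d) 2 (leb T)) :
    HasDerivAt (fun s : ℝ => F (K (x + s • y)))
      ⟪ContinuousLinearMap.adjoint K (gradient F (K x)), y⟫_ℝ 0 := by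
  have hG : HasFDerivAt F (innerSL ℝ (gradient F (K x))) (K (x + (0 : ℝ) • y)) := by
    rw [zero_smul, add_zero]
    exact ((hF.differentiable one_ne_zero) (K x)).hasGradientAt.hasFDerivAt
  have hL : HasDerivAt (fun s : ℝ => K (x + s • y)) (K y) 0 := by
    have h : HasDerivAt (fun s : ℝ => x + s • y) y 0 := by
      simpa using ((hasDerivAt_id (0 : ℝ)).smul_const y).const_add x
    exact K.hasFDerivAt.comp_hasDerivAt 0 h
  rw [ContinuousLinearMap.adjoint_inner_left]
  exact hG.comp_hasDerivAt 0 hL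

/-- On the segment from x to y this is the one-variable fact that the derivative at 0 is at most the
slope over [0, 1]. -/
theorem inner_gradient_le_sub (hF : ConvexOn ℝ univ F) (hF' : ContDiff ℝ 1 F) (x y : Y) :
    ⟪gradient F x, y - x⟫_ℝ ≤ F y - F x := by
  have hd : HasDerivAt (fun s : ℝ => F (x + s • (y - x))) ⟪gradient F x, y - x⟫_ℝ 0 := by
    have hG : HasFDerivAt F (innerSL ℝ (gradient F x)) (x + (0 : ℝ) • (y - x)) := by
      rw [zero_smul, add_zero]
      exact ((hF'.differentiable one_ne_zero) x).hasGradientAt.hasFDerivAt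
    have h : HasDerivAt (fun s : ℝ => x + s • (y - x)) (y - x) 0 := by
      simpa using ((hasDerivAt_id (0 : ℝ)).smul_const (y - x)).const_add x
    exact hG.comp_hasDerivAt 0 h
  have hc : ConvexOn ℝ univ fun s : ℝ => F (x + s • (y - x)) := by
    have := hF.comp_affineMap (AffineMap.lineMap (k := ℝ) x y)
    simpa [Function.comp_def, AffineMap.lineMap_apply, add_comm] using this
  have := hc.le_slope_of_hasDerivAt (mem_univ 0) (mem_univ 1) zero_lt_one hd
  simpa [slope_def_field] using this

theorem jumpSum_update {N : ℕ} (v : Fin N → Jump T d) (μ : Fin N → ℝ) (i : Fin N) (s : ℝ) :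
    jumpSum v (Function.update μ i (μ i + s)) = jumpSum v μ + s • (v i).measure := by
  have h : Function.update μ i (μ i + s) = μ + Pi.single i s := by
    ext j
    rcases eq_or_ne j i with rfl | hj <;> simp [*]
  have h1 : ∑ j, (Pi.single i s : Fin N → ℝ) j • (v j).measure = s • (v i).measure := by
    rw [Finset.sum_eq_single i (fun j _ hj => ?_) (by simp), Pi.single_eq_same]
    rw [Pi.single_eq_of_ne hj]
    exact zero_smul ℝ (v j).measure
  rw [h, jumpSum, jumpSum, ← h1, ← Finset.sum_add_distrib]
  exact Finset.sum_congr rfl fun j _ => add_smul (μ j) _ (v j).measure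

variable {N : ℕ} {v : Fin N → Jump T d} {μ : Fin N → ℝ} {c : Vec d}

/-- Optimality of the offset: `∫_0^T K* ∇F(Ku) dt = 0`. -/
theorem IsSubMinimizer.integral_eq_zero (h : IsSubMinimizer K F β v μ c) (hF' : ContDiff ℝ 1 F) :
    ∫ t, ContinuousLinearMap.adjoint K
      (gradient F (K (BV.toL2 (bvOf (jumpSum v μ) c)))) t ∂leb T = 0 := by
  set f := ContinuousLinearMap.adjoint K (gradient F (K (BV.toL2 (bvOf (jumpSum v μ) c)))) with hf
  refine ext_inner_right ℝ fun e => ?_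
  -- The variation B(0, e) is the constant function e. The offset is unconstrained, so every step s
  -- is admissible.
  have hd := hasDerivAt_comp_add_smul hF' K (BV.toL2 (bvOf (jumpSum v μ) c))
    (BV.toL2 (bvOf (0 : VMeas T d) e))
  have hmin : IsLocalMin (fun s : ℝ => F (K (BV.toL2 (bvOf (jumpSum v μ) c) +
      s • BV.toL2 (bvOf (0 : VMeas T d) e)))) 0 := by
    refine Eventually.of_forall fun s => ?_
    have h1 := h.2 μ (c + s • e) h.1
    simp only [subObjective, add_le_add_iff_right] at h1
    have h2 := toL2_bvOf_add_smul (jumpSum v μ) 0 c e s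
    have h3 : s • (0 : VMeas T d) = 0 := smul_zero (A := VMeas T d) s
    rw [h3, add_zero] at h2
    simpa only [← h2, zero_smul, add_zero] using h1
  have h1 := hmin.hasDerivAt_eq_zero hd
  rw [← hf, L2.inner_def] at h1
  have hfi : Integrable f (leb T) := (Lp.memLp f).integrable one_le_two
  rw [inner_zero_left, real_inner_comm, ← integral_inner hfi, ← h1]
  refine integral_congr_ae ?_
  filter_upwards [coeFn_toL2_bvOf (0 : VMeas T d) e] with t ht
  rw [ht, real_inner_comm]
  simp [bvFun, primitive]

/-- Optimality of the magnitudes: the dual variable equals `β` on active jumps. -/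
theorem IsSubMinimizer.inner_dualVar_eq (hT : 0 < T) (h : IsSubMinimizer K F β v μ c)
    (hF' : ContDiff ℝ 1 F) {i : Fin N} (hi : 0 < μ i) :
    ⟪dualVar K F (bvOf (jumpSum v μ) c) (v i).pos, (v i).dir⟫_ℝ = β := by
  have hd := (hasDerivAt_comp_add_smul hF' K (BV.toL2 (bvOf (jumpSum v μ) c))
    (BV.toL2 (bvOf (v i).measure (0 : Vec d)))).add
    ((hasDerivAt_id (0 : ℝ)).const_mul β)
  have hmin : IsLocalMin ((fun s : ℝ => F (K (BV.toL2 (bvOf (jumpSum v μ) c) +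
      s • BV.toL2 (bvOf (v i).measure (0 : Vec d))))) + fun s : ℝ => β * id s) 0 := by
    -- As μ_i > 0, the magnitude μ_i + s stays nonnegative for small s of either sign; hence an
    -- equation and not just an inequality.
    filter_upwards [eventually_ge_nhds (neg_lt_zero.2 hi)] with s hs
    have h1 := h.2 (Function.update μ i (μ i + s)) c fun j => by
      rcases eq_or_ne j i with rfl | hj
      · rw [Function.update_self]
        linarith
      · rw [Function.update_of_ne hj]
        exact h.1 j
    have h2 : ∑ j, Function.update μ i (μ i + s) j = ∑ j, μ j + s := by
      rw [Finset.sum_update_of_mem (Finset.mem_univ i),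
        ← Finset.add_sum_erase _ μ (Finset.mem_univ i), Finset.sdiff_singleton_eq_erase]
      ring
    simp only [subObjective, jumpSum_update, h2] at h1
    have h3 := toL2_bvOf_add_smul (jumpSum v μ) (v i).measure c 0 s
    rw [smul_zero, add_zero] at h3
    simp only [Pi.add_apply, id, ← h3, zero_smul, add_zero, mul_zero]
    linarith
  have h1 := hmin.hasDerivAt_eq_zero hd
  -- Integration by parts turns the stationarity condition into -⟨p, v_i⟩ + β = 0.
  rw [inner_toL2 hT _ (h.integral_eq_zero hF'), deriv_bvOf, pairing_measure] at h1
  have h2 : ⟪dualVar K F (bvOf (jumpSum v μ) c) (v i).pos, (v i).dir⟫_ℝ =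
    ⟪∫ s in (0 : ℝ)..(v i).pos, ContinuousLinearMap.adjoint K
      (gradient F (K (BV.toL2 (bvOf (jumpSum v μ) c)))) s, (v i).dir⟫_ℝ := rfl
  linarith

/-- The discarded magnitudes are nonnegative and not positive, hence zero. So the iterate is the
subproblem solution itself and inherits its optimality conditions. -/
theorem IsPruned.jumpSum_eq {A : ActiveSet T d} (h : IsPruned v μ A) (hμ : ∀ i, 0 ≤ μ i) :
    jumpSum A.jump A.weight = jumpSum v μ := by
  obtain ⟨e, he⟩ := h
  have h1 : jumpSum A.jump A.weight =
      ∑ i : {i : Fin N // 0 < μ i}, μ i • (v i).measure := by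
    rw [jumpSum, ← e.sum_comp]
    exact Finset.sum_congr rfl fun i _ => by rw [(he i).1, (he i).2]
  rw [h1, jumpSum, ← Finset.sum_subtype (Finset.univ.filter fun i => 0 < μ i) (by simp)
    fun i => μ i • (v i).measure]
  refine Finset.sum_subset (Finset.filter_subset _ _) fun i _ hi => ?_
  have h0 : μ i = 0 := le_antisymm (by simpa using hi) (hμ i)
  rw [h0]
  exact zero_smul ℝ (v i).measure

/-- An iterate is given by a solution of the subproblem from which it is pruned. -/
theorem IsRun.exists_isSubMinimizer {n : ℕ∞} {A : ℕ → ActiveSet T d} {c : ℕ → Vec d}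
    (h : IsRun K F β n A c) {k : ℕ} (hk : 1 ≤ k) (hkn : (k : ℕ∞) ≤ n) :
    ∃ (N : ℕ) (v : Fin N → Jump T d) (μ : Fin N → ℝ),
      IsSubMinimizer K F β v μ (c k) ∧ IsPruned v μ (A k) := by
  obtain ⟨k, rfl⟩ := Nat.exists_eq_add_of_le' hk
  -- After the shift, iteration k + 1 is produced by `init` if k = 0 and by step k otherwise.
  rcases Nat.eq_zero_or_pos k with rfl | hk
  · obtain ⟨μ, hμ⟩ := h.init
    exact ⟨_, _, μ, hμ⟩
  · have hlt : (k : ℕ∞) < n := lt_of_lt_of_le (by exact_mod_cast k.lt_succ_self) hkn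
    obtain ⟨-, vhat, -, μ, hμ⟩ := h.step k hk hlt
    exact ⟨_, _, μ, hμ⟩

/-- The sufficient optimality condition `‖p‖_C ≤ β`. -/
theorem isMinimizer_of_norm_le (hT : 0 < T) (hF : ConvexOn ℝ univ F) (hF' : ContDiff ℝ 1 F)
    {u : BV T d} (h0 : ∫ t, ContinuousLinearMap.adjoint K (gradient F (K (BV.toL2 u))) t ∂leb T = 0)
    {P : C₀(Interval T, Vec d)} (hP : ⇑P = dualVar K F u) (hPβ : ‖P‖ ≤ β)
    (hu : β * mnorm (BV.deriv u) ≤ pairing P (BV.deriv u)) : IsMinimizer K F β u := by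
  intro w
  -- After integration by parts this reads ⟨p, u'⟩ - ⟨p, w'⟩ ≤ F(Kw) - F(Ku).
  have h1 := inner_gradient_le_sub hF hF' (K (BV.toL2 u)) (K (BV.toL2 w))
  rw [← map_sub, ← ContinuousLinearMap.adjoint_inner_left, inner_sub_right,
    inner_toL2 hT _ h0, inner_toL2 hT _ h0] at h1
  have h2 : (fun t : Interval T => ∫ s in (0 : ℝ)..t,
    ContinuousLinearMap.adjoint K (gradient F (K (BV.toL2 u))) s) = ⇑P := hP.symm
  rw [h2] at h1
  have h3 := (pairing_le P (BV.deriv w)).trans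
    (mul_le_mul_of_nonneg_right hPβ (mnorm_nonneg (BV.deriv w)))
  simp only [objective]
  linarith

end Optimality

end PDAJ

/-! ### The proposition. -/

theorem mainTheorem6 {T : ℝ} (hT : 0 < T) {d : ℕ} {Y : Type*} [NormedAddCommGroup Y]
    [InnerProductSpace ℝ Y] [CompleteSpace Y] (K : Lp (Vec d) 2 (leb T) →L[ℝ] Y)
    (F : Y → ℝ) (hF : StrictConvexOn ℝ univ F) (hF' : ContDiff ℝ 1 F) (β : ℝ) (hβ : 0 < β)
    (hj : ∀ w : ℕ → BV T d, Tendsto (fun i => bvNorm (w i)) atTop atTop →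
      Tendsto (fun i => objective K F β (w i)) atTop atTop)
    (n : ℕ∞) (A : ℕ → ActiveSet T d) (c : ℕ → Vec d) (hrun : IsRun K F β n A c)
    (k : ℕ) (hk : 1 ≤ k) (hkn : (k : ℕ∞) ≤ n)
    (u : BV T d) (hu : u = (A k).iterate (c k))
    (p : Interval T → Vec d) (hp : p = dualVar K F u) :
    (∃ P : C₀(Interval T, Vec d), ⇑P = p) ∧
    (∀ i, pairing p ((A k).jump i).measure = ⟪p ((A k).jump i).pos, ((A k).jump i).dir⟫_ℝ ∧
      ⟪p ((A k).jump i).pos, ((A k).jump i).dir⟫_ℝ = β) ∧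
    pairing p (BV.deriv u) = β * ∑ i, (A k).weight i ∧
    (0 < (A k).card → β ≤ cnorm p) ∧
    (cnorm p ≤ β → IsMinimizer K F β u) ∧
    (∀ vhat : Jump T d, IsCandidate p vhat → (∃ i, (A k).jump i = vhat) →
      cnorm p = β ∧ IsMinimizer K F β u) := by
  obtain ⟨N, v, μ, hmin, hprune⟩ := hrun.exists_isSubMinimizer hk hkn
  have hsum := hprune.jumpSum_eq hmin.1
  have hu' : u = bvOf (jumpSum v μ) (c k) := by rw [hu, ActiveSet.iterate, hsum]
  have h0 : ∫ t, ContinuousLinearMap.adjoint K (gradient F (K (BV.toL2 u))) t ∂leb T = 0 := by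
    rw [hu']
    exact hmin.integral_eq_zero hF'
  obtain ⟨P, hP⟩ : ∃ P : C₀(Interval T, Vec d), ⇑P = p := by
    rw [hp]
    exact exists_zeroAtInfty_eq_potential hT.le ((Lp.memLp _).integrable one_le_two) h0
  have hinner (i) : ⟪p ((A k).jump i).pos, ((A k).jump i).dir⟫_ℝ = β := by
    obtain ⟨e, he⟩ := hprune
    rw [(he i).2, hp, hu']
    exact hmin.inner_dualVar_eq hT hF' (e i).2
  have hderiv : BV.deriv u = jumpSum (A k).jump (A k).weight := by
    rw [hu, ActiveSet.iterate, deriv_bvOf]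
  have hpair : pairing p (BV.deriv u) = β * ∑ i, (A k).weight i := by
    rw [hderiv, ← hP, pairing_jumpSum, hP, Finset.mul_sum]
    exact Finset.sum_congr rfl fun i _ => by rw [hinner i, mul_comm]
  have hnorm : cnorm p = ‖P‖ := by rw [← hP, cnorm_eq_norm]
  have hopt (h : cnorm p ≤ β) : IsMinimizer K F β u := by
    refine isMinimizer_of_norm_le hT hF.convexOn hF' h0 (hP.trans hp) (hnorm ▸ h) ?_
    -- What remains is β‖u'‖ ≤ β ∑ μ_i, the triangle inequality for the jumps.
    rw [hP, hpair, hderiv]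
    exact mul_le_mul_of_nonneg_left
      (mnorm_jumpSum_le _ fun i => ((A k).weight_pos i).le) hβ.le
  refine ⟨⟨P, hP⟩, fun i => ⟨pairing_measure p _, hinner i⟩, hpair, fun hcard => ?_, hopt, ?_⟩
  · rw [hnorm, ← hinner ⟨0, hcard⟩]
    refine (real_inner_le_norm _ _).trans ?_
    rw [Jump.norm_dir, mul_one, ← hP]
    exact norm_apply_le_norm P _
  · rintro _ ⟨hpos, hmax, hdir⟩ ⟨i, rfl⟩
    -- At the candidate, (p(t), p(t)/‖p‖) = ‖p‖; being active, the same jump pairs to β.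
    have hβ' : cnorm p = β := by
      rw [← hinner i, hdir, real_inner_smul_right, real_inner_self_eq_norm_sq, hmax, sq,
        inv_mul_cancel_left₀ hpos.ne']
    exact ⟨hβ', hopt hβ'.le⟩
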